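/- A residuated lattice is an algebra $(A,\vee,\wedge,\odot,\rightarrow,0,1)$ such that $(A,\vee,\wedge,0,1)$ is a bounded lattice, $(A,\odot,1)$ is a commutative monoid, and $a\le b\rightarrow c$ iff $a\odot b\le c$ for all $a,b,c\in A$. A filter of $A$ is a non-empty subset of $A$ that is closed under $\odot$ and upward closed. A filter $F$ is proper if $F\neq A$; a maximal filter is a maximal element, under inclusion, of the set of proper filters; a prime filter is a proper filter $P$ such that $a\vee b\in P$ implies $a\in P$ or $b\in P$. The radical ${\rm Rad}(A)$ is the intersection of all maximal filters of $A$ (so ${\rm Rad}(A)=A$ if $A$ is trivial). For a filter $F$, $A/F$ is the quotient residuated lattice of $A$ by the congruence $a\equiv b$ iff $(a\rightarrow b)\wedge(b\rightarrow a)\in F$. Let ${\cal B}(A)$ be the set of complemented elements of the bounded lattice $A$. A filter $F$ has the Boolean Lifting Property (BLP) if ${\cal B}(A/F)=\{e/F : e\in{\cal B}(A)\}$. $A$ is called Gelfand if every prime filter of $A$ is included in a unique maximal filter of $A$. For a bounded distributive lattice $L$, filters, maximal filters, the radical and ${\cal B}(L)$ are defined in the same way with $\wedge$ in place of $\odot$;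 $L/F$ is the quotient by the congruence $x\equiv y$ iff $x\wedge a=y\wedge a$ for some $a\in F$; and BLP for $F$ again means ${\cal B}(L/F)=\{e/F: e\in{\cal B}(L)\}$. $L$ is conormal if for all $x,y\in L$ with $x\wedge y=0$ there are $u,v\in L$ with $u\vee v=1$ and $u\wedge x=v\wedge y=0$. Then: 1. If $A$ is a Gelfand residuated lattice, then ${\rm Rad}(A)$ has BLP. 2. If $A$ is an MV-algebra $(A,\oplus,\neg,0)$, regarded as a residuated lattice with $a\odot b=\neg(\neg a\oplus\neg b)$, $a\rightarrow b=\neg a\oplus b$, $a\vee b=\neg(\neg a\oplus b)\oplus b$, $a\wedge b=\neg(\neg a\vee\neg b)$ and $1=\neg 0$, then ${\rm Rad}(A)$ has BLP. 3. If $A$ is a BL-algebra, that is, a residuated lattice with $(a\rightarrow b)\vee(b\rightarrow a)=1$ and $a\wedge b=a\odot(a\rightarrow b)$ for all $a,b\in A$, then ${\rm Rad}(A)$ has BLP. 4. If $L$ is a conormal bounded distributive lattice, then ${\rm Rad}(L)$ has BLP. -/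

import Mathlib

/-- Commutative integral bounded residuated lattices `(A, ∨, ∧, ⊙, →, 0, 1)`. The multiplication is
`*`, the residuum is `⇨`, the constants `0` and `1` are `⊥` and `⊤`, and the unit of the monoid is
the top element. -/
class ResiduatedLattice (A : Type*) extends Lattice A, BoundedOrder A, CommMonoid A, HImp A where
  one_eq_top : (1 : A) = ⊤
  le_himp_iff : ∀ a b c : A, a ≤ b ⇨ c ↔ a * b ≤ c

/-- BL-algebras: residuated lattices with prelinearity and divisibility. -/
class BLAlgebra (A : Type*) extends ResiduatedLattice A where
  prelinear : ∀ a b : A, (a ⇨ b) ⊔ (b ⇨ a) = ⊤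
  divisible : ∀ a b : A, a ⊓ b = a * (a ⇨ b)

/-- MV-algebras `(A, ⊕, ¬, 0)`; the sum is `+`, the negation is `ᶜ`. -/
class MVAlgebra (A : Type*) extends AddCommMonoid A, Compl A where
  compl_compl : ∀ a : A, aᶜᶜ = a
  add_compl_zero : ∀ a : A, a + (0 : A)ᶜ = (0 : A)ᶜ
  lukasiewicz : ∀ a b : A, (aᶜ + b)ᶜ + b = (bᶜ + a)ᶜ + a

namespace MVAlgebra

section
variable {A : Type*} [MVAlgebra A]

theorem compl_add_self (a : A) : aᶜ + a = (0 : A)ᶜ := by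
  have h := lukasiewicz a (0 : A)ᶜ
  rw [add_compl_zero, compl_compl, zero_add] at h
  exact h.symm

theorem le_iff_exists (a b : A) : aᶜ + b = (0 : A)ᶜ ↔ ∃ c, b = a + c := by
  constructor
  · intro h
    refine ⟨(bᶜ + a)ᶜ, ?_⟩
    have h2 := lukasiewicz a b
    rw [h, compl_compl, zero_add] at h2
    rw [add_comm a]
    exact h2
  · rintro ⟨c, rfl⟩
    rw [← add_assoc, compl_add_self, add_comm, add_compl_zero]

theorem le_trans' (a b c : A) (h1 : aᶜ + b = (0 : A)ᶜ) (h2 : bᶜ + c = (0 : A)ᶜ) :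
    aᶜ + c = (0 : A)ᶜ := by
  obtain ⟨d, rfl⟩ := (le_iff_exists _ _).1 h1
  obtain ⟨e, rfl⟩ := (le_iff_exists _ _).1 h2
  exact (le_iff_exists _ _).2 ⟨d + e, add_assoc _ _ _⟩

theorem compl_anti (a b : A) (h : aᶜ + b = (0 : A)ᶜ) : bᶜᶜ + aᶜ = (0 : A)ᶜ := by
  rw [compl_compl, add_comm, h]

theorem add_mono' (a b c : A) (h : aᶜ + b = (0 : A)ᶜ) : (a + c)ᶜ + (b + c) = (0 : A)ᶜ := by
  obtain ⟨d, rfl⟩ := (le_iff_exists _ _).1 h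
  exact (le_iff_exists _ _).2 ⟨d, add_right_comm _ _ _⟩

theorem le_sup_right' (a b : A) : bᶜ + ((aᶜ + b)ᶜ + b) = (0 : A)ᶜ :=
  (le_iff_exists _ _).2 ⟨_, add_comm _ _⟩

theorem le_sup_left' (a b : A) : aᶜ + ((aᶜ + b)ᶜ + b) = (0 : A)ᶜ := by
  rw [lukasiewicz]
  exact le_sup_right' b a

theorem sup_le' (a b c : A) (h1 : aᶜ + c = (0 : A)ᶜ) (h2 : bᶜ + c = (0 : A)ᶜ) :
    ((aᶜ + b)ᶜ + b)ᶜ + c = (0 : A)ᶜ := by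
  have h := add_mono' _ _ b (compl_anti _ _ (add_mono' _ _ b (compl_anti _ _ h1)))
  rwa [lukasiewicz c b, h2, compl_compl, zero_add] at h

end

/-- The residuated lattice of an MV-algebra: `a ≤ b` iff `¬a ⊕ b = 1`, `a ⊙ b = ¬(¬a ⊕ ¬b)`,
`a → b = ¬a ⊕ b`, `a ∨ b = ¬(¬a ⊕ b) ⊕ b`, `a ∧ b = ¬(¬a ∨ ¬b)`. -/
instance toResiduatedLattice {A : Type*} [MVAlgebra A] : ResiduatedLattice A where
  le a b := aᶜ + b = (0 : A)ᶜ
  le_refl := compl_add_self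
  le_trans := le_trans'
  le_antisymm a b h1 h2 := by
    have h := lukasiewicz a b
    change aᶜ + b = (0 : A)ᶜ at h1
    change bᶜ + a = (0 : A)ᶜ at h2
    rw [h1, h2, compl_compl, zero_add, zero_add] at h
    exact h.symm
  sup a b := (aᶜ + b)ᶜ + b
  le_sup_left := le_sup_left'
  le_sup_right := le_sup_right'
  sup_le := sup_le'
  inf a b := ((aᶜᶜ + bᶜ)ᶜ + bᶜ)ᶜ
  inf_le_left a b := by
    have h := compl_anti _ _ (le_sup_left' aᶜ bᶜ)
    rwa [compl_compl a] at h ⊢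
  inf_le_right a b := by
    have h := compl_anti _ _ (le_sup_right' aᶜ bᶜ)
    rwa [compl_compl b] at h
  le_inf a b c h1 h2 := by
    have h := compl_anti _ _ (sup_le' bᶜ cᶜ aᶜ (compl_anti _ _ h1) (compl_anti _ _ h2))
    rwa [compl_compl a] at h
  top := (0 : A)ᶜ
  bot := 0
  le_top a := add_compl_zero aᶜ
  bot_le a := by
    rw [add_comm, add_compl_zero]
  mul a b := (aᶜ + bᶜ)ᶜ
  one := (0 : A)ᶜ
  mul_assoc a b c := by
    change ((aᶜ + bᶜ)ᶜᶜ + cᶜ)ᶜ = (aᶜ + (bᶜ + cᶜ)ᶜᶜ)ᶜ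
    rw [compl_compl, compl_compl, add_assoc]
  mul_comm a b := congrArg (·ᶜ) (add_comm aᶜ bᶜ)
  one_mul a := by
    change ((0 : A)ᶜᶜ + aᶜ)ᶜ = a
    rw [compl_compl, zero_add, compl_compl]
  mul_one a := by
    change (aᶜ + (0 : A)ᶜᶜ)ᶜ = a
    rw [compl_compl, add_zero, compl_compl]
  himp a b := aᶜ + b
  one_eq_top := rfl
  le_himp_iff a b c := by
    change aᶜ + (bᶜ + c) = (0 : A)ᶜ ↔ (aᶜ + bᶜ)ᶜᶜ + c = (0 : A)ᶜ
    rw [compl_compl, add_assoc]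

end MVAlgebra

/-- Filters of a residuated lattice. -/
@[ext]
structure RLFilter (A : Type*) [ResiduatedLattice A] where
  carrier : Set A
  nonempty : carrier.Nonempty
  mul_mem : ∀ {a b : A}, a ∈ carrier → b ∈ carrier → a * b ∈ carrier
  up_mem : ∀ {a b : A}, a ∈ carrier → a ≤ b → b ∈ carrier

namespace ResiduatedLattice

section
variable {A : Type*} [ResiduatedLattice A]

/-- The biresiduum `a ↔ b = (a → b) ∧ (b → a)`. -/
def biresiduum (a b : A) : A := (a ⇨ b) ⊓ (b ⇨ a)

theorem himp_mul_le (a b : A) : (a ⇨ b) * a ≤ b := (le_himp_iff _ _ _).1 le_rfl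

theorem mul_le_mul_r (c : A) {a b : A} (h : a ≤ b) : a * c ≤ b * c :=
  (le_himp_iff _ _ _).1 (h.trans ((le_himp_iff _ _ _).2 le_rfl))

theorem mul_le_mul_l (c : A) {a b : A} (h : a ≤ b) : c * a ≤ c * b := by
  rw [mul_comm c a, mul_comm c b]
  exact mul_le_mul_r c h

theorem mul_le_l (a b : A) : a * b ≤ a := by
  have h := mul_le_mul_l a (le_top : b ≤ ⊤)
  rwa [← one_eq_top, mul_one] at h

theorem mul_le_r (a b : A) : a * b ≤ b := by
  rw [mul_comm]
  exact mul_le_l b a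

theorem mul_le_comm {a b c : A} : a * b ≤ c ↔ b ≤ a ⇨ c := by
  rw [le_himp_iff, mul_comm]

end

end ResiduatedLattice

namespace RLFilter

open ResiduatedLattice

section
variable {A : Type*} [ResiduatedLattice A]

instance : SetLike (RLFilter A) A where
  coe := carrier
  coe_injective _ _ h := RLFilter.ext h

/-- Proper filters. -/
def IsProper (F : RLFilter A) : Prop := (F : Set A) ≠ Set.univ

/-- Maximal filters: the maximal elements, under inclusion, of the set of proper filters. -/
def IsMaximal (M : RLFilter A) : Prop :=
  M.IsProper ∧ ∀ F : RLFilter A, F.IsProper → (M : Set A) ⊆ F → (F : Set A) = M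

/-- Prime filters. -/
def IsPrime (P : RLFilter A) : Prop :=
  P.IsProper ∧ ∀ a b : A, a ⊔ b ∈ P → a ∈ P ∨ b ∈ P

theorem one_mem (F : RLFilter A) : (1 : A) ∈ F := by
  obtain ⟨a, ha⟩ := F.nonempty
  exact F.up_mem ha (by rw [one_eq_top]; exact le_top)

/-- `a/F ≤ b/F` -/
theorem himp_mem_iff (F : RLFilter A) (a b : A) : a ⇨ b ∈ F ↔ ∃ f ∈ F, f * a ≤ b :=
  ⟨fun h => ⟨_, h, himp_mul_le a b⟩, fun ⟨_, hf, h⟩ => F.up_mem hf ((le_himp_iff _ _ _).2 h)⟩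

theorem biresiduum_mem_iff (F : RLFilter A) (a b : A) :
    biresiduum a b ∈ F ↔ a ⇨ b ∈ F ∧ b ⇨ a ∈ F :=
  ⟨fun h => ⟨F.up_mem h inf_le_left, F.up_mem h inf_le_right⟩,
    fun h => F.up_mem (F.mul_mem h.1 h.2) (le_inf (mul_le_l _ _) (mul_le_r _ _))⟩

theorem himp_self_mem (F : RLFilter A) (a : A) : a ⇨ a ∈ F :=
  (F.himp_mem_iff _ _).2 ⟨1, F.one_mem, by rw [one_mul]⟩

theorem himp_mem_of_le (F : RLFilter A) {a b : A} (h : a ≤ b) : a ⇨ b ∈ F :=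
  (F.himp_mem_iff _ _).2 ⟨1, F.one_mem, by rwa [one_mul]⟩

theorem himp_mem_trans (F : RLFilter A) {a b c : A} (h1 : a ⇨ b ∈ F) (h2 : b ⇨ c ∈ F) :
    a ⇨ c ∈ F := by
  obtain ⟨f, hf, h1⟩ := (F.himp_mem_iff _ _).1 h1
  obtain ⟨g, hg, h2⟩ := (F.himp_mem_iff _ _).1 h2
  refine (F.himp_mem_iff _ _).2 ⟨g * f, F.mul_mem hg hf, ?_⟩
  rw [mul_assoc]
  exact (mul_le_mul_l g h1).trans h2

theorem sup_himp_mem (F : RLFilter A) {a b c : A} (h1 : a ⇨ c ∈ F) (h2 : b ⇨ c ∈ F) :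
    (a ⊔ b) ⇨ c ∈ F := by
  obtain ⟨f, hf, h1⟩ := (F.himp_mem_iff _ _).1 h1
  obtain ⟨g, hg, h2⟩ := (F.himp_mem_iff _ _).1 h2
  refine (F.himp_mem_iff _ _).2 ⟨f * g, F.mul_mem hf hg, mul_le_comm.2 (sup_le ?_ ?_)⟩
  · exact mul_le_comm.1 ((mul_le_mul_r a (mul_le_l f g)).trans h1)
  · exact mul_le_comm.1 ((mul_le_mul_r b (mul_le_r f g)).trans h2)

theorem himp_inf_mem (F : RLFilter A) {a b c : A} (h1 : a ⇨ b ∈ F) (h2 : a ⇨ c ∈ F) :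
    a ⇨ (b ⊓ c) ∈ F := by
  obtain ⟨f, hf, h1⟩ := (F.himp_mem_iff _ _).1 h1
  obtain ⟨g, hg, h2⟩ := (F.himp_mem_iff _ _).1 h2
  refine (F.himp_mem_iff _ _).2 ⟨f * g, F.mul_mem hf hg, le_inf ?_ ?_⟩
  · exact (mul_le_mul_r a (mul_le_l f g)).trans h1
  · exact (mul_le_mul_r a (mul_le_r f g)).trans h2

theorem mul_himp_mul_mem (F : RLFilter A) {a a' b b' : A} (h1 : a ⇨ a' ∈ F) (h2 : b ⇨ b' ∈ F) :
    (a * b) ⇨ (a' * b') ∈ F := by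
  obtain ⟨f, hf, h1⟩ := (F.himp_mem_iff _ _).1 h1
  obtain ⟨g, hg, h2⟩ := (F.himp_mem_iff _ _).1 h2
  refine (F.himp_mem_iff _ _).2 ⟨f * g, F.mul_mem hf hg, ?_⟩
  rw [mul_mul_mul_comm]
  exact (mul_le_mul_l _ h2).trans (mul_le_mul_r _ h1)

theorem himp_himp_himp_mem (F : RLFilter A) {a a' b b' : A} (h1 : a' ⇨ a ∈ F)
    (h2 : b ⇨ b' ∈ F) : (a ⇨ b) ⇨ (a' ⇨ b') ∈ F := by
  obtain ⟨f, hf, h1⟩ := (F.himp_mem_iff _ _).1 h1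
  obtain ⟨g, hg, h2⟩ := (F.himp_mem_iff _ _).1 h2
  refine (F.himp_mem_iff _ _).2 ⟨g * f, F.mul_mem hg hf, (le_himp_iff _ _ _).2 ?_⟩
  have e : g * f * (a ⇨ b) * a' = g * ((a ⇨ b) * (f * a')) := by
    rw [mul_assoc g f, mul_comm f, mul_assoc, mul_assoc]
  rw [e]
  exact (mul_le_mul_l g ((mul_le_mul_l _ h1).trans (himp_mul_le a b))).trans h2

/-- The congruence modulo `F`: `a ≡ b (mod F)` iff `a ↔ b ∈ F`. -/
def setoid (F : RLFilter A) : Setoid A where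
  r a b := biresiduum a b ∈ F
  iseqv := by
    refine ⟨fun a => ?_, fun {a b} h => ?_, fun {a b c} h1 h2 => ?_⟩
    · exact (F.biresiduum_mem_iff _ _).2 ⟨F.himp_self_mem a, F.himp_self_mem a⟩
    · exact (F.biresiduum_mem_iff _ _).2 ((F.biresiduum_mem_iff _ _).1 h).symm
    · rw [biresiduum_mem_iff] at *
      exact ⟨F.himp_mem_trans h1.1 h2.1, F.himp_mem_trans h2.2 h1.2⟩

/-- The quotient `A/F`. -/
def Quo (F : RLFilter A) : Type _ := Quotient F.setoid

/-- The canonical surjection `a ↦ a/F`. -/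
def proj (F : RLFilter A) (a : A) : F.Quo := Quotient.mk F.setoid a

theorem rel_iff (F : RLFilter A) (a b : A) : F.setoid.r a b ↔ a ⇨ b ∈ F ∧ b ⇨ a ∈ F :=
  F.biresiduum_mem_iff a b

theorem sup_rel (F : RLFilter A) {a a' b b' : A} (h1 : a ⇨ a' ∈ F) (h2 : b ⇨ b' ∈ F) :
    (a ⊔ b) ⇨ (a' ⊔ b') ∈ F :=
  F.sup_himp_mem (F.himp_mem_trans h1 (F.himp_mem_of_le le_sup_left))
    (F.himp_mem_trans h2 (F.himp_mem_of_le le_sup_right))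

theorem inf_rel (F : RLFilter A) {a a' b b' : A} (h1 : a ⇨ a' ∈ F) (h2 : b ⇨ b' ∈ F) :
    (a ⊓ b) ⇨ (a' ⊓ b') ∈ F :=
  F.himp_inf_mem (F.himp_mem_trans (F.himp_mem_of_le inf_le_left) h1)
    (F.himp_mem_trans (F.himp_mem_of_le inf_le_right) h2)

/-- The residuated lattice `A/F`, with the operations induced from `A`. Its lattice order is
`a/F ≤ b/F` iff `a → b ∈ F`. -/
instance (F : RLFilter A) : ResiduatedLattice F.Quo where
  le := Quotient.lift₂ (fun a b => a ⇨ b ∈ F) (by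
    intro a b a' b' h1 h2
    replace h1 := (F.rel_iff _ _).1 h1
    replace h2 := (F.rel_iff _ _).1 h2
    exact propext ⟨fun h => F.himp_mem_trans h1.2 (F.himp_mem_trans h h2.1),
      fun h => F.himp_mem_trans h1.1 (F.himp_mem_trans h h2.2)⟩)
  le_refl := by
    rintro ⟨a⟩
    exact F.himp_self_mem a
  le_trans := by
    rintro ⟨a⟩ ⟨b⟩ ⟨c⟩ h1 h2
    exact F.himp_mem_trans h1 h2
  le_antisymm := by
    rintro ⟨a⟩ ⟨b⟩ h1 h2
    exact Quotient.sound ((F.rel_iff _ _).2 ⟨h1, h2⟩)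
  sup := Quotient.map₂ (· ⊔ ·) (by
    intro a a' h1 b b' h2
    replace h1 := (F.rel_iff _ _).1 h1
    replace h2 := (F.rel_iff _ _).1 h2
    exact (F.rel_iff _ _).2 ⟨F.sup_rel h1.1 h2.1, F.sup_rel h1.2 h2.2⟩)
  le_sup_left := by
    rintro ⟨a⟩ ⟨b⟩
    exact F.himp_mem_of_le le_sup_left
  le_sup_right := by
    rintro ⟨a⟩ ⟨b⟩
    exact F.himp_mem_of_le le_sup_right
  sup_le := by
    rintro ⟨a⟩ ⟨b⟩ ⟨c⟩ h1 h2
    exact F.sup_himp_mem h1 h2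
  inf := Quotient.map₂ (· ⊓ ·) (by
    intro a a' h1 b b' h2
    replace h1 := (F.rel_iff _ _).1 h1
    replace h2 := (F.rel_iff _ _).1 h2
    exact (F.rel_iff _ _).2 ⟨F.inf_rel h1.1 h2.1, F.inf_rel h1.2 h2.2⟩)
  inf_le_left := by
    rintro ⟨a⟩ ⟨b⟩
    exact F.himp_mem_of_le inf_le_left
  inf_le_right := by
    rintro ⟨a⟩ ⟨b⟩
    exact F.himp_mem_of_le inf_le_right
  le_inf := by
    rintro ⟨a⟩ ⟨b⟩ ⟨c⟩ h1 h2
    exact F.himp_inf_mem h1 h2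
  top := F.proj ⊤
  bot := F.proj ⊥
  le_top := by
    rintro ⟨a⟩
    exact F.himp_mem_of_le le_top
  bot_le := by
    rintro ⟨a⟩
    exact F.himp_mem_of_le bot_le
  mul := Quotient.map₂ (· * ·) (by
    intro a a' h1 b b' h2
    replace h1 := (F.rel_iff _ _).1 h1
    replace h2 := (F.rel_iff _ _).1 h2
    exact (F.rel_iff _ _).2 ⟨F.mul_himp_mul_mem h1.1 h2.1, F.mul_himp_mul_mem h1.2 h2.2⟩)
  one := F.proj 1
  mul_assoc := by
    rintro ⟨a⟩ ⟨b⟩ ⟨c⟩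
    exact congrArg F.proj (mul_assoc a b c)
  mul_comm := by
    rintro ⟨a⟩ ⟨b⟩
    exact congrArg F.proj (mul_comm a b)
  one_mul := by
    rintro ⟨a⟩
    exact congrArg F.proj (one_mul a)
  mul_one := by
    rintro ⟨a⟩
    exact congrArg F.proj (mul_one a)
  himp := Quotient.map₂ (· ⇨ ·) (by
    intro a a' h1 b b' h2
    replace h1 := (F.rel_iff _ _).1 h1
    replace h2 := (F.rel_iff _ _).1 h2
    exact (F.rel_iff _ _).2 ⟨F.himp_himp_himp_mem h1.2 h2.1, F.himp_himp_himp_mem h1.1 h2.2⟩)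
  one_eq_top := congrArg F.proj one_eq_top
  le_himp_iff := by
    rintro ⟨a⟩ ⟨b⟩ ⟨c⟩
    change a ⇨ (b ⇨ c) ∈ F ↔ (a * b) ⇨ c ∈ F
    simp only [himp_mem_iff, ResiduatedLattice.le_himp_iff, mul_assoc]

end

end RLFilter

/-- The Boolean center: the set of complemented elements. -/
def booleanCenter (A : Type*) [Lattice A] [BoundedOrder A] : Set A := {a | IsComplemented a}

/-- The Boolean Lifting Property of a filter `F` of `A`: the Boolean center of `A/F` is the image
of the Boolean center of `A` under `a ↦ a/F`. -/
def RLFilter.HasBLP {A : Type*} [ResiduatedLattice A] (F : RLFilter A) : Prop :=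
  booleanCenter F.Quo = F.proj '' booleanCenter A

namespace ResiduatedLattice

/-- The radical of `A`: the intersection of all maximal filters of `A`
(the improper filter if `A` is trivial). -/
def radical (A : Type*) [ResiduatedLattice A] : RLFilter A where
  carrier := {a | ∀ M : RLFilter A, M.IsMaximal → a ∈ M}
  nonempty := ⟨1, fun M _ => M.one_mem⟩
  mul_mem ha hb M hM := M.mul_mem (ha M hM) (hb M hM)
  up_mem ha hab M hM := M.up_mem (ha M hM) hab

/-- Gelfand residuated lattices: every prime filter is included in a unique maximal filter. -/
def IsGelfand (A : Type*) [ResiduatedLattice A] : Prop :=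
  ∀ P : RLFilter A, P.IsPrime → ∃! M : RLFilter A, M.IsMaximal ∧ (P : Set A) ⊆ M

end ResiduatedLattice

/-- Filters of a bounded lattice. -/
@[ext]
structure LatFilter (L : Type*) [Lattice L] where
  carrier : Set L
  nonempty : carrier.Nonempty
  inf_mem : ∀ {a b : L}, a ∈ carrier → b ∈ carrier → a ⊓ b ∈ carrier
  up_mem : ∀ {a b : L}, a ∈ carrier → a ≤ b → b ∈ carrier

namespace LatFilter

instance {L : Type*} [Lattice L] : SetLike (LatFilter L) L where
  coe := carrier
  coe_injective _ _ h := LatFilter.ext h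

/-- Proper filters. -/
def IsProper {L : Type*} [Lattice L] (F : LatFilter L) : Prop := (F : Set L) ≠ Set.univ

/-- Maximal filters: the maximal elements, under inclusion, of the set of proper filters. -/
def IsMaximal {L : Type*} [Lattice L] (M : LatFilter L) : Prop :=
  M.IsProper ∧ ∀ F : LatFilter L, F.IsProper → (M : Set L) ⊆ F → (F : Set L) = M

section
variable {L : Type*} [DistribLattice L]

/-- `x/F ≤ y/F` -/
def Le (F : LatFilter L) (x y : L) : Prop := ∃ a ∈ F, x ⊓ a ≤ y

theorem Le.trans {F : LatFilter L} {x y z : L} (h1 : F.Le x y) (h2 : F.Le y z) : F.Le x z := by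
  obtain ⟨a, ha, h1⟩ := h1
  obtain ⟨b, hb, h2⟩ := h2
  refine ⟨a ⊓ b, F.inf_mem ha hb, ?_⟩
  rw [← inf_assoc]
  exact (inf_le_inf_right b h1).trans h2

theorem Le.sup_le {F : LatFilter L} {x y z : L} (h1 : F.Le x z) (h2 : F.Le y z) :
    F.Le (x ⊔ y) z := by
  obtain ⟨a, ha, h1⟩ := h1
  obtain ⟨b, hb, h2⟩ := h2
  refine ⟨a ⊓ b, F.inf_mem ha hb, ?_⟩
  rw [inf_sup_right]
  exact _root_.sup_le ((inf_le_inf_left x inf_le_left).trans h1)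
    ((inf_le_inf_left y inf_le_right).trans h2)

theorem Le.le_inf {F : LatFilter L} {x y z : L} (h1 : F.Le x y) (h2 : F.Le x z) :
    F.Le x (y ⊓ z) := by
  obtain ⟨a, ha, h1⟩ := h1
  obtain ⟨b, hb, h2⟩ := h2
  exact ⟨a ⊓ b, F.inf_mem ha hb, _root_.le_inf ((inf_le_inf_left x inf_le_left).trans h1)
    ((inf_le_inf_left x inf_le_right).trans h2)⟩

end

section
variable {L : Type*} [DistribLattice L] [BoundedOrder L]

theorem top_mem (F : LatFilter L) : (⊤ : L) ∈ F := by
  obtain ⟨a, ha⟩ := F.nonempty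
  exact F.up_mem ha le_top

/-- The congruence modulo `F`: `x ≡ y (mod F)` iff `x ∧ a = y ∧ a` for some `a ∈ F`. -/
def setoid (F : LatFilter L) : Setoid L where
  r x y := ∃ a ∈ F, x ⊓ a = y ⊓ a
  iseqv := by
    refine ⟨fun x => ⟨⊤, F.top_mem, rfl⟩, fun ⟨a, ha, h⟩ => ⟨a, ha, h.symm⟩, ?_⟩
    rintro x y z ⟨a, ha, h1⟩ ⟨b, hb, h2⟩
    refine ⟨a ⊓ b, F.inf_mem ha hb, ?_⟩
    rw [← inf_assoc, h1, inf_right_comm, h2, inf_right_comm, inf_assoc]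

/-- The quotient `L/F`. -/
def Quo (F : LatFilter L) : Type _ := Quotient F.setoid

/-- The canonical surjection `x ↦ x/F`. -/
def proj (F : LatFilter L) (x : L) : F.Quo := Quotient.mk F.setoid x

theorem Le.of_le (F : LatFilter L) {x y : L} (h : x ≤ y) : F.Le x y :=
  ⟨⊤, F.top_mem, inf_le_left.trans h⟩

theorem rel_iff (F : LatFilter L) (x y : L) : F.setoid.r x y ↔ F.Le x y ∧ F.Le y x := by
  constructor
  · rintro ⟨a, ha, h⟩
    exact ⟨⟨a, ha, h.le.trans inf_le_left⟩, ⟨a, ha, h.ge.trans inf_le_left⟩⟩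
  · rintro ⟨⟨a, ha, h1⟩, ⟨b, hb, h2⟩⟩
    refine ⟨a ⊓ b, F.inf_mem ha hb, le_antisymm ?_ ?_⟩
    · exact _root_.le_inf ((inf_le_inf_left x inf_le_left).trans h1) inf_le_right
    · exact _root_.le_inf ((inf_le_inf_left y inf_le_right).trans h2) inf_le_right

/-- The distributive lattice `L/F`, with the operations induced from `L`. -/
instance (F : LatFilter L) : DistribLattice F.Quo where
  le := Quotient.lift₂ F.Le (by
    intro x y x' y' h1 h2
    replace h1 := (F.rel_iff _ _).1 h1
    replace h2 := (F.rel_iff _ _).1 h2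
    exact propext ⟨fun h => h1.2.trans (h.trans h2.1), fun h => h1.1.trans (h.trans h2.2)⟩)
  le_refl := by
    rintro ⟨x⟩
    exact Le.of_le F le_rfl
  le_trans := by
    rintro ⟨x⟩ ⟨y⟩ ⟨z⟩ h1 h2
    exact Le.trans h1 h2
  le_antisymm := by
    rintro ⟨x⟩ ⟨y⟩ h1 h2
    exact Quotient.sound ((F.rel_iff _ _).2 ⟨h1, h2⟩)
  sup := Quotient.map₂ (· ⊔ ·) (by
    intro x x' h1 y y' h2
    replace h1 := (F.rel_iff _ _).1 h1
    replace h2 := (F.rel_iff _ _).1 h2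
    exact (F.rel_iff _ _).2
      ⟨(h1.1.trans (Le.of_le F le_sup_left)).sup_le (h2.1.trans (Le.of_le F le_sup_right)),
        (h1.2.trans (Le.of_le F le_sup_left)).sup_le (h2.2.trans (Le.of_le F le_sup_right))⟩)
  le_sup_left := by
    rintro ⟨x⟩ ⟨y⟩
    exact Le.of_le F le_sup_left
  le_sup_right := by
    rintro ⟨x⟩ ⟨y⟩
    exact Le.of_le F le_sup_right
  sup_le := by
    rintro ⟨x⟩ ⟨y⟩ ⟨z⟩ h1 h2
    exact Le.sup_le h1 h2
  inf := Quotient.map₂ (· ⊓ ·) (by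
    intro x x' h1 y y' h2
    replace h1 := (F.rel_iff _ _).1 h1
    replace h2 := (F.rel_iff _ _).1 h2
    exact (F.rel_iff _ _).2
      ⟨((Le.of_le F inf_le_left).trans h1.1).le_inf ((Le.of_le F inf_le_right).trans h2.1),
        ((Le.of_le F inf_le_left).trans h1.2).le_inf ((Le.of_le F inf_le_right).trans h2.2)⟩)
  inf_le_left := by
    rintro ⟨x⟩ ⟨y⟩
    exact Le.of_le F inf_le_left
  inf_le_right := by
    rintro ⟨x⟩ ⟨y⟩
    exact Le.of_le F inf_le_right
  le_inf := by
    rintro ⟨x⟩ ⟨y⟩ ⟨z⟩ h1 h2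
    exact Le.le_inf h1 h2
  le_sup_inf := by
    rintro ⟨x⟩ ⟨y⟩ ⟨z⟩
    exact Le.of_le F le_sup_inf

instance (F : LatFilter L) : BoundedOrder F.Quo where
  top := F.proj ⊤
  bot := F.proj ⊥
  le_top := by
    rintro ⟨x⟩
    exact Le.of_le F le_top
  bot_le := by
    rintro ⟨x⟩
    exact Le.of_le F bot_le

/-- The Boolean Lifting Property of a filter `F` of `L`: the Boolean center of `L/F` is the image
of the Boolean center of `L` under `x ↦ x/F`. -/
def HasBLP (F : LatFilter L) : Prop :=
  booleanCenter F.Quo = F.proj '' booleanCenter L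

end

/-- The radical of `L`: the intersection of all maximal filters of `L`. -/
def radical (L : Type*) [DistribLattice L] [BoundedOrder L] : LatFilter L where
  carrier := {a | ∀ M : LatFilter L, M.IsMaximal → a ∈ M}
  nonempty := ⟨⊤, fun M _ => M.top_mem⟩
  inf_mem ha hb M hM := M.inf_mem (ha M hM) (hb M hM)
  up_mem ha hab M hM := M.up_mem (ha M hM) hab

end LatFilter

/-- Conormal bounded distributive lattices. -/
def IsConormal (L : Type*) [DistribLattice L] [BoundedOrder L] : Prop :=
  ∀ x y : L, x ⊓ y = ⊥ → ∃ u v : L, u ⊔ v = ⊤ ∧ u ⊓ x = ⊥ ∧ v ⊓ y = ⊥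

/-! Quotient maps preserve complements, so BLP of the radical means that every complemented class
has a complemented representative. If $a/{\rm Rad}(A)$ has complement $b/{\rm Rad}(A)$, each maximal
filter contains exactly one of $a$, $b$; it suffices to find a complemented $e$ lying in the same
maximal filters as $a$.

In the Gelfand case (`IsGelfand.exists_isComplemented`), let $D_c$ be the set of elements lying in
no maximal filter that contains $c$. If no join of an element of $D_a$ with one of $D_b$ were $1$,
Zorn would give a prime filter missing all such joins, and it would lie below a maximal filter
containing $a$ and another containing $b$, against uniqueness. So $x\vee y=1$ with $x\in D_a$, $y\in
D_b$. Then $x\odot y$ is in no maximal filter, hence nilpotent, and $y^n$, $x^n$ are complementary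
for some $n$.

MV- and BL-algebras are prelinear, and prelinearity implies Gelfand. For lattices, conormality
supplies the complementary pair directly. -/

namespace RLFilter

open ResiduatedLattice

section
variable {A : Type*} [ResiduatedLattice A]

/-! ### Prime and maximal filters of residuated lattices -/

theorem top_mem (F : RLFilter A) : (⊤ : A) ∈ F := one_eq_top (A := A) ▸ F.one_mem

theorem isProper_iff (F : RLFilter A) : F.IsProper ↔ (⊥ : A) ∉ F := by
  refine ⟨fun h hb => h (Set.eq_univ_of_forall fun a => F.up_mem hb bot_le), fun h hu => h ?_⟩
  change (⊥ : A) ∈ (F : Set A)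
  rw [hu]
  trivial

theorem inf_mem (F : RLFilter A) {a b : A} (ha : a ∈ F) (hb : b ∈ F) : a ⊓ b ∈ F :=
  F.up_mem (F.mul_mem ha hb) (le_inf (mul_le_l _ _) (mul_le_r _ _))

theorem mem_of_himp_mem (F : RLFilter A) {a b : A} (h : a ⇨ b ∈ F) (ha : a ∈ F) : b ∈ F :=
  F.up_mem (F.mul_mem h ha) (himp_mul_le a b)

theorem himp_mem_of_mem (F : RLFilter A) {a b : A} (hb : b ∈ F) : a ⇨ b ∈ F :=
  F.up_mem hb ((le_himp_iff _ _ _).2 (mul_le_l _ _))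

theorem pow_mem (F : RLFilter A) {a : A} (ha : a ∈ F) (n : ℕ) : a ^ n ∈ F := by
  induction n with
  | zero => rw [pow_zero]; exact F.one_mem
  | succ n ih => rw [pow_succ]; exact F.mul_mem ih ha

theorem sup_mul_sup_le (x y b : A) : (x ⊔ b) * (y ⊔ b) ≤ x * y ⊔ b := by
  refine (le_himp_iff _ _ _).1 (sup_le ?_ ?_)
  · refine (le_himp_iff _ _ _).2 (mul_le_comm.2 (sup_le ?_ ?_))
    · exact mul_le_comm.1 le_sup_left
    · exact mul_le_comm.1 ((mul_le_r _ _).trans le_sup_right)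
  · exact (le_himp_iff _ _ _).2 ((mul_le_l _ _).trans le_sup_right)

/-- The filter `{⊤}`. -/
def trivialFilter (A : Type*) [ResiduatedLattice A] : RLFilter A where
  carrier := {⊤}
  nonempty := ⟨⊤, rfl⟩
  mul_mem := by
    rintro a b rfl rfl
    change (⊤ : A) * ⊤ = ⊤
    rw [← one_eq_top, mul_one]
  up_mem := by
    rintro a b rfl h
    exact top_le_iff.1 h

/-- The filter of all `x` with `x ∨ b ∈ F`. -/
def residual (F : RLFilter A) (b : A) : RLFilter A where
  carrier := {x | x ⊔ b ∈ F}
  nonempty := ⟨⊤, F.up_mem F.top_mem le_sup_left⟩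
  mul_mem hx hy := F.up_mem (F.mul_mem hx hy) (sup_mul_sup_le _ _ _)
  up_mem hx h := F.up_mem hx (sup_le_sup_right h _)

/-- The filter generated by `F` and `a`. -/
def adjoin (F : RLFilter A) (a : A) : RLFilter A where
  carrier := {x | ∃ p ∈ F, ∃ n : ℕ, p * a ^ n ≤ x}
  nonempty := ⟨⊤, 1, F.one_mem, 0, le_top⟩
  mul_mem := by
    rintro x y ⟨p, hp, n, hx⟩ ⟨q, hq, m, hy⟩
    refine ⟨p * q, F.mul_mem hp hq, n + m, ?_⟩
    rw [pow_add, mul_mul_mul_comm]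
    exact (mul_le_mul_l _ hy).trans (mul_le_mul_r _ hx)
  up_mem := by
    rintro x y ⟨p, hp, n, hx⟩ h
    exact ⟨p, hp, n, hx.trans h⟩

theorem le_adjoin (F : RLFilter A) (a : A) : (F : Set A) ⊆ F.adjoin a :=
  fun p hp => ⟨p, hp, 0, by rw [pow_zero, mul_one]⟩

theorem mem_adjoin (F : RLFilter A) (a : A) : a ∈ F.adjoin a :=
  ⟨1, F.one_mem, 1, by rw [pow_one, one_mul]⟩

/-- Zorn's lemma for filters disjoint from a set. -/
theorem exists_maximal_disjoint (F : RLFilter A) (S : Set A) (h : ∀ x ∈ S, x ∉ F) :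
    ∃ P : RLFilter A, (F : Set A) ⊆ P ∧ (∀ x ∈ S, x ∉ P) ∧
      ∀ Q : RLFilter A, (∀ x ∈ S, x ∉ Q) → (P : Set A) ⊆ Q → (Q : Set A) = P := by
  let T : Set (Set A) := {s | ∃ Q : RLFilter A, (Q : Set A) = s ∧ ∀ x ∈ S, x ∉ Q}
  obtain ⟨m, hFm, hm⟩ := zorn_subset_nonempty T (by
    intro c hc hchain hne
    refine ⟨⋃₀ c, ⟨⟨⋃₀ c, ?_, ?_, ?_⟩, rfl, ?_⟩, fun s hs => Set.subset_sUnion_of_mem hs⟩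
    · obtain ⟨s, hs⟩ := hne
      obtain ⟨Q, rfl, -⟩ := hc hs
      exact ⟨⊤, _, hs, Q.top_mem⟩
    · rintro a b ⟨s, hs, ha⟩ ⟨t, ht, hb⟩
      rcases hchain.total hs ht with hst | hst
      · obtain ⟨Q, rfl, -⟩ := hc ht
        exact ⟨_, ht, Q.mul_mem (hst ha) hb⟩
      · obtain ⟨Q, rfl, -⟩ := hc hs
        exact ⟨_, hs, Q.mul_mem ha (hst hb)⟩
    · rintro a b ⟨s, hs, ha⟩ hab
      obtain ⟨Q, rfl, -⟩ := hc hs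
      exact ⟨_, hs, Q.up_mem ha hab⟩
    · rintro x hx ⟨s, hs, hxs⟩
      obtain ⟨Q, rfl, hQ⟩ := hc hs
      exact hQ x hx hxs) F ⟨F, rfl, h⟩
  obtain ⟨P, rfl, hP⟩ := hm.prop
  exact ⟨P, hFm, hP, fun Q hQ hPQ => (hm.le_of_ge ⟨Q, rfl, hQ⟩ hPQ).antisymm hPQ⟩

/-- A filter maximal among those disjoint from a `∨`-closed set satisfies the prime condition. -/
theorem mem_or_mem_of_maximal_disjoint {P : RLFilter A} {S : Set A}
    (hS : ∀ x ∈ S, ∀ y ∈ S, x ⊔ y ∈ S) (hP : ∀ x ∈ S, x ∉ P)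
    (hmax : ∀ Q : RLFilter A, (∀ x ∈ S, x ∉ Q) → (P : Set A) ⊆ Q → (Q : Set A) = P)
    {a b : A} (hab : a ⊔ b ∈ P) : a ∈ P ∨ b ∈ P := by
  -- Here `P.residual y` strictly extends `P`, so by maximality it meets `S`. Two uses replace first
  -- `a` and then `b` by elements of `S`, putting an element of `S` in `P`.
  have key : ∀ x y : A, x ⊔ y ∈ P → x ∉ P → ∃ s ∈ S, s ⊔ y ∈ P := by
    intro x y hxy hx
    by_contra! hs
    have h := hmax (P.residual y) hs fun z hz => P.up_mem hz le_sup_left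
    have hx' : x ∈ (P.residual y : Set A) := hxy
    rw [h] at hx'
    exact hx hx'
  by_contra! hn
  obtain ⟨s, hs, hsb⟩ := key a b hab hn.1
  obtain ⟨t, ht, hts⟩ := key b s (by rwa [sup_comm]) hn.2
  exact hP _ (hS t ht s hs) hts

/-- Proper filters are those disjoint from the $\vee$-closed set $\{0\}$, so this is an instance of
`mem_or_mem_of_maximal_disjoint`. -/
theorem IsMaximal.isPrime {M : RLFilter A} (hM : M.IsMaximal) : M.IsPrime := by
  refine ⟨hM.1, fun a b hab => ?_⟩
  refine mem_or_mem_of_maximal_disjoint (S := {⊥}) ?_ ?_ ?_ hab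
  · rintro x rfl y rfl
    exact sup_idem _
  · rintro x rfl
    exact (isProper_iff M).1 hM.1
  · exact fun Q hQ => hM.2 Q ((isProper_iff Q).2 (hQ ⊥ rfl))

theorem IsProper.exists_isMaximal {F : RLFilter A} (hF : F.IsProper) :
    ∃ M : RLFilter A, M.IsMaximal ∧ (F : Set A) ⊆ M := by
  obtain ⟨M, hFM, hM, hmax⟩ := exists_maximal_disjoint F {⊥} (by
    rintro x rfl
    exact (isProper_iff F).1 hF)
  refine ⟨M, ⟨(isProper_iff M).2 (hM ⊥ rfl), fun Q hQ => hmax Q ?_⟩, hFM⟩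
  rintro x rfl
  exact (isProper_iff Q).1 hQ

/-- Otherwise the filter generated by `F` and `a` is proper and extends to a maximal one. With `F`
trivial this says that an element of no maximal filter is nilpotent. -/
theorem exists_mul_pow_eq_bot (F : RLFilter A) (a : A)
    (h : ∀ M : RLFilter A, M.IsMaximal → (F : Set A) ⊆ M → a ∉ M) :
    ∃ p ∈ F, ∃ n : ℕ, p * a ^ n = ⊥ := by
  by_contra! hn
  have hp : (F.adjoin a).IsProper := by
    rw [isProper_iff]
    rintro ⟨p, hp, n, hb⟩
    exact hn p hp n (le_bot_iff.1 hb)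
  obtain ⟨M, hM, hFM⟩ := hp.exists_isMaximal
  exact h M hM ((F.le_adjoin a).trans hFM) (hFM (F.mem_adjoin a))

theorem IsMaximal.not_mem_of_mul_eq_bot {M : RLFilter A} (hM : M.IsMaximal) {a b : A}
    (h : a * b = ⊥) (ha : a ∈ M) : b ∉ M :=
  fun hb => (isProper_iff M).1 hM.1 (h ▸ M.mul_mem ha hb)

theorem proj_eq_iff (F : RLFilter A) {a b : A} :
    F.proj a = F.proj b ↔ a ⇨ b ∈ F ∧ b ⇨ a ∈ F :=
  Quotient.eq.trans (F.rel_iff a b)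

theorem image_booleanCenter_subset (F : RLFilter A) :
    F.proj '' booleanCenter A ⊆ booleanCenter F.Quo := by
  rintro _ ⟨a, ⟨b, hab⟩, rfl⟩
  refine ⟨F.proj b, ?_⟩
  rw [isCompl_iff, disjoint_iff, codisjoint_iff] at *
  exact ⟨congrArg F.proj hab.1, congrArg F.proj hab.2⟩

/-- Complemented elements of `A/F`, in terms of representatives. -/
theorem exists_of_proj_isComplemented (F : RLFilter A) {a : A}
    (h : IsComplemented (F.proj a)) : ∃ b : A, a ⊔ b ∈ F ∧ (a ⊓ b) ⇨ ⊥ ∈ F := by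
  obtain ⟨b, hb⟩ := h
  obtain ⟨b, rfl⟩ : ∃ b', F.proj b' = b := Quotient.exists_rep b
  rw [isCompl_iff, disjoint_iff, codisjoint_iff] at hb
  have h1 : F.proj (a ⊓ b) = F.proj ⊥ := hb.1
  have h2 : F.proj (a ⊔ b) = F.proj ⊤ := hb.2
  exact ⟨b, F.mem_of_himp_mem ((F.proj_eq_iff).1 h2).2 F.top_mem, ((F.proj_eq_iff).1 h1).1⟩

end

end RLFilter

/-! ### Gelfand residuated lattices -/

namespace ResiduatedLattice

open RLFilter

section
variable {A : Type*} [ResiduatedLattice A]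

/-- For fixed $y$ the elements $x$ with $x\vee y=1$ form a filter, so $x$ may be replaced by its
powers; then the roles are exchanged. -/
theorem pow_sup_pow_eq_top {x y : A} (h : x ⊔ y = ⊤) (n : ℕ) : x ^ n ⊔ y ^ n = ⊤ := by
  have h1 : x ^ n ⊔ y = ⊤ := ((trivialFilter A).residual y).pow_mem (a := x) h n
  have h2 : y ^ n ⊔ x ^ n = ⊤ :=
    ((trivialFilter A).residual (x ^ n)).pow_mem (a := y) (by rw [sup_comm] at h1; exact h1) n
  rwa [sup_comm]

/-- Both $x$ and $y$ multiply $x\wedge y$ to $0$, hence so does their join $1$. -/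
theorem inf_eq_bot_of_mul_eq_bot {x y : A} (h : x ⊔ y = ⊤) (hxy : x * y = ⊥) : x ⊓ y = ⊥ := by
  refine le_bot_iff.1 ?_
  have h1 : x ⊔ y ≤ (x ⊓ y) ⇨ ⊥ := by
    refine sup_le ?_ ?_ <;> refine (le_himp_iff _ _ _).2 ?_
    · exact (mul_le_mul_l _ inf_le_right).trans hxy.le
    · exact (mul_le_mul_l _ inf_le_left).trans (by rw [mul_comm, hxy])
  rw [h, le_himp_iff, ← one_eq_top, one_mul] at h1
  exact h1

/-- In a Gelfand residuated lattice, a partition of the maximal filters into those containing `a`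
and those containing `b` is induced by a complemented element. -/
theorem IsGelfand.exists_isComplemented (hA : IsGelfand A) {a b : A}
    (hor : ∀ M : RLFilter A, M.IsMaximal → a ∈ M ∨ b ∈ M)
    (hand : ∀ M : RLFilter A, M.IsMaximal → a ∈ M → b ∉ M) :
    ∃ e : A, IsComplemented e ∧ ∀ M : RLFilter A, M.IsMaximal → (e ∈ M ↔ a ∈ M) := by
  let D : A → Set A := fun c => {x | ∀ M : RLFilter A, M.IsMaximal → c ∈ M → x ∉ M}
  have hD : ∀ c, ∀ x ∈ D c, ∀ y ∈ D c, x ⊔ y ∈ D c := fun c x hx y hy M hM hc hxy =>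
    (hM.isPrime.2 x y hxy).elim (hx M hM hc) (hy M hM hc)
  have hbot : ∀ c, ⊥ ∈ D c := fun c M hM _ => (isProper_iff M).1 hM.1
  obtain ⟨x, hx, y, hy, hxy⟩ : ∃ x ∈ D a, ∃ y ∈ D b, x ⊔ y = ⊤ := by
    -- `S` is the ideal generated by `D a` and `D b`; it misses `⊤`, so some filter `P` is maximal
    -- among those disjoint from it, and `P` is prime.
    by_contra! hn
    let S : Set A := {z | ∃ x ∈ D a, ∃ y ∈ D b, x ⊔ y = z}
    have hS : ∀ x ∈ S, ∀ y ∈ S, x ⊔ y ∈ S := by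
      rintro _ ⟨x, hx, y, hy, rfl⟩ _ ⟨x', hx', y', hy', rfl⟩
      exact ⟨x ⊔ x', hD a x hx x' hx', y ⊔ y', hD b y hy y' hy', sup_sup_sup_comm x x' y y'⟩
    obtain ⟨P, -, hP, hmax⟩ := exists_maximal_disjoint (trivialFilter A) S (by
      rintro _ ⟨x, hx, y, hy, rfl⟩ h
      exact hn x hx y hy h)
    have hprime : P.IsPrime := by
      refine ⟨(isProper_iff P).2 (hP ⊥ ⟨⊥, hbot a, ⊥, hbot b, sup_idem _⟩), fun u v huv => ?_⟩
      exact mem_or_mem_of_maximal_disjoint hS hP hmax huv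
    -- If no maximal filter above `P` contained `c`, some `p ∈ P` would satisfy $p\odot c^n=0$,
    -- which forces `p ∈ D c`.
    have key : ∀ c, (∀ x ∈ D c, x ∉ P) →
        ∃ M : RLFilter A, M.IsMaximal ∧ (P : Set A) ⊆ M ∧ c ∈ M := by
      intro c hc
      by_contra! hno
      obtain ⟨p, hp, n, hpn⟩ := P.exists_mul_pow_eq_bot c hno
      refine hc p (fun M hM hcM hpM => ?_) hp
      exact hM.not_mem_of_mul_eq_bot hpn hpM (M.pow_mem hcM n)
    obtain ⟨M, hM, hPM, haM⟩ := key a fun x hx => hP x ⟨x, hx, ⊥, hbot b, sup_bot_eq x⟩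
    obtain ⟨N, hN, hPN, hbN⟩ := key b fun x hx => hP x ⟨⊥, hbot a, x, hx, bot_sup_eq x⟩
    have h := (hA P hprime).unique ⟨hM, hPM⟩ ⟨hN, hPN⟩
    exact hand M hM haM (h ▸ hbN)
  -- Every maximal filter contains `a` or `b`, hence omits `x` or `y`.
  have hno : ∀ M : RLFilter A, M.IsMaximal →
      (trivialFilter A : Set A) ⊆ M → x * y ∉ M := by
    intro M hM _ h
    rcases hor M hM with haM | hbM
    · exact hx M hM haM (M.up_mem h (mul_le_l _ _))
    · exact hy M hM hbM (M.up_mem h (mul_le_r _ _))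
  obtain ⟨p, hp, n, hpn⟩ := (trivialFilter A).exists_mul_pow_eq_bot (x * y) hno
  obtain rfl : p = ⊤ := hp
  rw [← one_eq_top, one_mul, mul_pow, mul_comm] at hpn
  have htop : y ^ n ⊔ x ^ n = ⊤ := pow_sup_pow_eq_top (by rwa [sup_comm]) n
  -- The witness is a power of `y`, since `y` avoids the maximal filters containing `b` and, because
  -- `x ⊔ y = ⊤`, lies in those containing `a`.
  refine ⟨y ^ n, ⟨x ^ n, isCompl_iff.2 ⟨disjoint_iff.2 (inf_eq_bot_of_mul_eq_bot htop hpn),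
    codisjoint_iff.2 htop⟩⟩, fun M hM => ⟨fun he => ?_, fun ha => ?_⟩⟩
  · refine (hor M hM).resolve_right fun hb => ?_
    rcases hM.isPrime.2 x y (hxy ▸ M.top_mem) with hxM | hyM
    · exact hM.not_mem_of_mul_eq_bot hpn he (M.pow_mem hxM n)
    · exact hy M hM hb hyM
  · refine M.pow_mem ((hM.isPrime.2 x y (hxy ▸ M.top_mem)).resolve_left (hx M hM ha)) n

theorem IsGelfand.radical_hasBLP (hA : IsGelfand A) : (radical A).HasBLP := by
  refine Set.Subset.antisymm ?_ (image_booleanCenter_subset _)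
  intro q hq
  obtain ⟨a, rfl⟩ : ∃ a', (radical A).proj a' = q := Quotient.exists_rep q
  obtain ⟨b, hsup, hinf⟩ := exists_of_proj_isComplemented (radical A) (a := a) hq
  have hor : ∀ M : RLFilter A, M.IsMaximal → a ∈ M ∨ b ∈ M :=
    fun M hM => hM.isPrime.2 a b (hsup M hM)
  have hand : ∀ M : RLFilter A, M.IsMaximal → a ∈ M → b ∉ M := fun M hM ha hb =>
    (isProper_iff M).1 hM.1 (M.mem_of_himp_mem (hinf M hM) (M.inf_mem ha hb))
  obtain ⟨e, he, heM⟩ := hA.exists_isComplemented hor hand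
  -- Both residua are checked in each maximal filter `M`: if `M` contains the consequent this is
  -- immediate; otherwise some element of `M` multiplies the antecedent to `⊥`.
  refine ⟨e, he, ((radical A).proj_eq_iff).2 ⟨fun M hM => ?_, fun M hM => ?_⟩⟩
  · obtain ⟨f, hf⟩ := he
    rw [isCompl_iff, disjoint_iff, codisjoint_iff] at hf
    rcases hM.isPrime.2 e f (hf.2 ▸ M.top_mem) with h | h
    · exact M.himp_mem_of_mem ((heM M hM).1 h)
    · refine M.up_mem h ((le_himp_iff _ _ _).2 (le_trans ?_ bot_le))
      rw [← hf.1]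
      exact le_inf (mul_le_r _ _) (mul_le_l _ _)
  · rcases hor M hM with h | h
    · exact M.himp_mem_of_mem ((heM M hM).2 h)
    · refine M.up_mem (M.mul_mem (hinf M hM) h) ((le_himp_iff _ _ _).2 (le_trans ?_ bot_le))
      rw [mul_assoc]
      exact (mul_le_mul_l _ (le_inf (mul_le_r _ _) (mul_le_l _ _))).trans (himp_mul_le _ _)

/-- Prelinear residuated lattices are Gelfand. -/
theorem isGelfand_of_prelinear (h : ∀ a b : A, (a ⇨ b) ⊔ (b ⇨ a) = ⊤) : IsGelfand A := by
  intro P hP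
  obtain ⟨M, hM, hPM⟩ := hP.1.exists_isMaximal
  refine ⟨M, ⟨hM, hPM⟩, ?_⟩
  rintro N ⟨hN, hPN⟩
  -- Filters above a prime filter form a chain: given `x ∈ N \ M` and `y ∈ M \ N`, the prime `P`
  -- contains `x ⇨ y` or `y ⇨ x`, and modus ponens contradicts the choice.
  have hNM : (N : Set A) ⊆ M ∨ (M : Set A) ⊆ N := by
    by_contra! hn
    obtain ⟨⟨x, hxN, hxM⟩, ⟨y, hyM, hyN⟩⟩ :=
      And.intro (Set.not_subset.1 hn.1) (Set.not_subset.1 hn.2)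
    rcases hP.2 _ _ ((h x y).symm ▸ P.top_mem) with hxy | hyx
    · exact hyN (N.mem_of_himp_mem (hPN hxy) hxN)
    · exact hxM (M.mem_of_himp_mem (hPM hyx) hyM)
  rcases hNM with hs | hs
  · exact SetLike.coe_injective (hN.2 M hM.1 hs).symm
  · exact SetLike.coe_injective (hM.2 N hN.1 hs)

end

end ResiduatedLattice

/-! ### Prelinearity of MV-algebras -/

namespace MVAlgebra

section
variable {A : Type*} [MVAlgebra A]

theorem mul_def (a b : A) : a * b = (aᶜ + bᶜ)ᶜ := rfl

/-- This is the De Morgan dual of the Łukasiewicz axiom; both sides are $p\wedge q$ by divisibility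
(`inf_eq_mul`). -/
theorem mul_compl_add_comm (p q : A) : p * (pᶜ + q) = q * (qᶜ + p) := by
  have h := congrArg (·ᶜ) (lukasiewicz pᶜ qᶜ)
  rw [compl_compl, compl_compl] at h
  rw [mul_def, mul_def, add_comm pᶜ (pᶜ + q)ᶜ, add_comm qᶜ (qᶜ + p)ᶜ, add_comm pᶜ q,
    add_comm qᶜ p]
  exact h.symm

theorem inf_eq_mul (a b : A) : a ⊓ b = a * (aᶜ + b) := by
  rw [mul_compl_add_comm, mul_def, add_comm bᶜ, add_comm bᶜ]
  change ((aᶜᶜ + bᶜ)ᶜ + bᶜ)ᶜ = _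
  rw [compl_compl]

theorem mul_compl_self (a : A) : a * aᶜ = ⊥ := by
  change (aᶜ + aᶜᶜ)ᶜ = 0
  rw [add_comm, compl_add_self, compl_compl]

theorem bot_mul' (a : A) : ⊥ * a = ⊥ :=
  le_bot_iff.1 (ResiduatedLattice.mul_le_l _ _)

theorem compl_mul_add (y w : A) : yᶜ * (y + w) = w * (wᶜ + yᶜ) := by
  have h := mul_compl_add_comm yᶜ w
  rwa [compl_compl] at h

theorem mul_compl_inf_mul_compl (x y : A) : (x * yᶜ) ⊓ (y * xᶜ) = ⊥ := by
  obtain ⟨z, hz⟩ : ∃ z, z = y * xᶜ := ⟨_, rfl⟩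
  obtain ⟨w, hw⟩ : ∃ w, w = (y + z)ᶜ := ⟨_, rfl⟩
  have hyw : y * w = ⊥ := by
    have : w = yᶜ * zᶜ := by rw [hw, mul_def, compl_compl, compl_compl]
    rw [this, ← mul_assoc, mul_compl_self, bot_mul']
  have e1 : (x * yᶜ)ᶜ + z = xᶜ + (y + z) := by
    rw [mul_def, compl_compl, compl_compl, add_assoc]
  -- Divisibility and commutativity of the meet turn the left side into $z\odot(w\oplus x)\odot(\neg
  -- z\oplus\neg y)$. The factor $z\odot(w\oplus x)$ equals $y\odot w\odot(\neg w\oplus\neg x)$,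
  -- which vanishes since $y\odot w=0$.
  rw [← hz, inf_eq_mul, e1, mul_right_comm, mul_compl_add_comm, ← hw, mul_right_comm,
    mul_comm (y + z), compl_mul_add, mul_assoc, mul_comm (zᶜ + yᶜ), ← mul_assoc]
  rw [show z * (w + x) = ⊥ from ?_, bot_mul']
  rw [hz, mul_assoc, add_comm w, compl_mul_add, ← mul_assoc, hyw, bot_mul']

/-- De Morgan dual of `mul_compl_inf_mul_compl`, because $\neg(a\odot\neg b)=a\rightarrow b$. -/
theorem prelinear (a b : A) : (a ⇨ b) ⊔ (b ⇨ a) = ⊤ := by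
  have h := congrArg (·ᶜ) (mul_compl_inf_mul_compl a b)
  change ((a * bᶜ)ᶜ ⊔ (b * aᶜ)ᶜ)ᶜᶜ = (0 : A)ᶜ at h
  rw [compl_compl, mul_def, mul_def, compl_compl, compl_compl, compl_compl, compl_compl] at h
  exact h

end

end MVAlgebra

/-! ### Conormal distributive lattices -/

namespace LatFilter

section
variable {L : Type*} [DistribLattice L] [BoundedOrder L]

theorem isProper_iff (F : LatFilter L) : F.IsProper ↔ (⊥ : L) ∉ F := by
  refine ⟨fun h hb => h (Set.eq_univ_of_forall fun a => F.up_mem hb bot_le), fun h hu => h ?_⟩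
  change (⊥ : L) ∈ (F : Set L)
  rw [hu]
  trivial

/-- The filter of all `x` with `x ∨ b ∈ F`. -/
def residual (F : LatFilter L) (b : L) : LatFilter L where
  carrier := {x | x ⊔ b ∈ F}
  nonempty := ⟨⊤, F.up_mem F.top_mem le_sup_left⟩
  inf_mem {x y} hx hy := by
    change x ⊓ y ⊔ b ∈ F
    rw [sup_inf_right]
    exact F.inf_mem hx hy
  up_mem hx h := F.up_mem hx (sup_le_sup_right h _)

/-- The principal filter of `a`. -/
def principal (a : L) : LatFilter L where
  carrier := Set.Ici a
  nonempty := ⟨a, le_rfl⟩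
  inf_mem := le_inf
  up_mem := le_trans

/-- If `b ∉ M`, then `M.residual b` is a proper filter above `M`, so it equals `M`; it contains `a`.
-/
theorem IsMaximal.mem_or_mem {M : LatFilter L} (hM : M.IsMaximal) {a b : L} (h : a ⊔ b ∈ M) :
    a ∈ M ∨ b ∈ M := by
  by_contra! hn
  have hp : (M.residual b).IsProper := by
    rw [isProper_iff]
    intro hb
    have hb' : ⊥ ⊔ b ∈ M := hb
    rw [bot_sup_eq] at hb'
    exact hn.2 hb'
  have heq := hM.2 _ hp fun z hz => M.up_mem hz le_sup_left
  have ha : a ∈ (M.residual b : Set L) := h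
  rw [heq] at ha
  exact hn.1 ha

theorem IsProper.exists_isMaximal {F : LatFilter L} (hF : F.IsProper) :
    ∃ M : LatFilter L, M.IsMaximal ∧ (F : Set L) ⊆ M := by
  let T : Set (Set L) := {s | ∃ Q : LatFilter L, (Q : Set L) = s ∧ Q.IsProper}
  obtain ⟨m, hFm, hm⟩ := zorn_subset_nonempty T (by
    intro c hc hchain hne
    refine ⟨⋃₀ c, ⟨⟨⋃₀ c, ?_, ?_, ?_⟩, rfl, (isProper_iff _).2 ?_⟩,
      fun s hs => Set.subset_sUnion_of_mem hs⟩
    · obtain ⟨s, hs⟩ := hne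
      obtain ⟨Q, rfl, -⟩ := hc hs
      exact ⟨⊤, _, hs, Q.top_mem⟩
    · rintro a b ⟨s, hs, ha⟩ ⟨t, ht, hb⟩
      rcases hchain.total hs ht with hst | hst
      · obtain ⟨Q, rfl, -⟩ := hc ht
        exact ⟨_, ht, Q.inf_mem (hst ha) hb⟩
      · obtain ⟨Q, rfl, -⟩ := hc hs
        exact ⟨_, hs, Q.inf_mem ha (hst hb)⟩
    · rintro a b ⟨s, hs, ha⟩ hab
      obtain ⟨Q, rfl, -⟩ := hc hs
      exact ⟨_, hs, Q.up_mem ha hab⟩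
    · rintro ⟨s, hs, hxs⟩
      obtain ⟨Q, rfl, hQ⟩ := hc hs
      exact (isProper_iff Q).1 hQ hxs) F ⟨F, rfl, hF⟩
  obtain ⟨P, rfl, hP⟩ := hm.prop
  exact ⟨P, ⟨hP, fun Q hQ hPQ => (hm.le_of_ge ⟨Q, rfl, hQ⟩ hPQ).antisymm hPQ⟩, hFm⟩

/-- The principal filter of a nonzero element is proper, so it extends to a maximal one. As meet is
idempotent, no powers are needed here. -/
theorem eq_bot_of_forall_isMaximal {a : L} (h : ∀ M : LatFilter L, M.IsMaximal → a ∉ M) :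
    a = ⊥ := by
  by_contra ha
  have hp : (principal a).IsProper := (isProper_iff _).2 fun hb => ha (le_bot_iff.1 hb)
  obtain ⟨M, hM, haM⟩ := hp.exists_isMaximal
  exact h M hM (haM (Set.mem_Ici.2 le_rfl))

theorem image_booleanCenter_subset (F : LatFilter L) :
    F.proj '' booleanCenter L ⊆ booleanCenter F.Quo := by
  rintro _ ⟨a, ⟨b, hab⟩, rfl⟩
  refine ⟨F.proj b, ?_⟩
  rw [isCompl_iff, disjoint_iff, codisjoint_iff] at *
  exact ⟨congrArg F.proj hab.1, congrArg F.proj hab.2⟩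

theorem proj_eq_iff (F : LatFilter L) {x y : L} :
    F.proj x = F.proj y ↔ ∃ a ∈ F, x ⊓ a = y ⊓ a :=
  Quotient.eq

/-- Complemented elements of `L/F`, in terms of representatives. -/
theorem exists_of_proj_isComplemented (F : LatFilter L) {a : L}
    (h : IsComplemented (F.proj a)) : ∃ b : L, a ⊔ b ∈ F ∧ ∃ r ∈ F, a ⊓ b ⊓ r = ⊥ := by
  obtain ⟨b, hb⟩ := h
  obtain ⟨b, rfl⟩ : ∃ b', F.proj b' = b := Quotient.exists_rep b
  rw [isCompl_iff, disjoint_iff, codisjoint_iff] at hb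
  have h1 : F.proj (a ⊓ b) = F.proj ⊥ := hb.1
  have h2 : F.proj (a ⊔ b) = F.proj ⊤ := hb.2
  obtain ⟨r, hr, h1⟩ := (F.proj_eq_iff).1 h1
  obtain ⟨s, hs, h2⟩ := (F.proj_eq_iff).1 h2
  rw [bot_inf_eq] at h1
  rw [top_inf_eq, inf_eq_right] at h2
  exact ⟨b, F.up_mem hs h2, r, hr, h1⟩

theorem radical_hasBLP (hL : IsConormal L) : (radical L).HasBLP := by
  refine Set.Subset.antisymm ?_ (image_booleanCenter_subset _)
  intro q hq
  obtain ⟨a, rfl⟩ : ∃ a', (radical L).proj a' = q := Quotient.exists_rep q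
  obtain ⟨b, hsup, r, hr, hinf⟩ := exists_of_proj_isComplemented (radical L) (a := a) hq
  -- Cutting down by `r` makes `a` and `b` genuinely disjoint, as conormality requires.
  obtain ⟨u, v, huv, hu, hv⟩ := hL (a ⊓ r) (b ⊓ r) (by
    rw [← inf_inf_distrib_right, hinf])
  -- A maximal filter contains `r` and one of `a`, `b`, so it omits `u` or `v`.
  have hbot : v ⊓ u = ⊥ := by
    refine eq_bot_of_forall_isMaximal fun M hM h => (isProper_iff M).1 hM.1 ?_
    rcases hM.mem_or_mem (hsup M hM) with haM | hbM
    · exact hu ▸ M.inf_mem (M.up_mem h inf_le_right) (M.inf_mem haM (hr M hM))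
    · exact hv ▸ M.inf_mem (M.up_mem h inf_le_left) (M.inf_mem hbM (hr M hM))
  -- `v` lifts the class of `a`: on the radical element `r ⊓ (a ⊔ b)` both restrict to `a ⊓ r`,
  -- since `v` kills `b ⊓ r` while `u` kills `a ⊓ r`, which therefore lies below `v`.
  refine ⟨v, ⟨u, isCompl_iff.2 ⟨disjoint_iff.2 hbot, codisjoint_iff.2 (by rwa [sup_comm])⟩⟩,
    ((radical L).proj_eq_iff).2 ⟨r ⊓ (a ⊔ b), (radical L).inf_mem hr hsup, ?_⟩⟩
  have h1 : v ⊓ (r ⊓ (a ⊔ b)) = v ⊓ (a ⊓ r) := by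
    rw [inf_sup_left, inf_sup_left, inf_comm r b, hv, sup_bot_eq, inf_comm r a]
  have h2 : a ⊓ (r ⊓ (a ⊔ b)) = a ⊓ r := by
    rw [inf_left_comm, inf_sup_self, inf_comm]
  have h3 : a ⊓ r = (u ⊔ v) ⊓ (a ⊓ r) := by rw [huv, top_inf_eq]
  rw [h1, h2]
  nth_rewrite 2 [h3]
  rw [inf_sup_right, hu, bot_sup_eq]

end

end LatFilter

theorem mainTheorem7 :
    (∀ (A : Type*) [ResiduatedLattice A], ResiduatedLattice.IsGelfand A →
      (ResiduatedLattice.radical A).HasBLP) ∧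
    (∀ (A : Type*) [MVAlgebra A], (ResiduatedLattice.radical A).HasBLP) ∧
    (∀ (A : Type*) [BLAlgebra A], (ResiduatedLattice.radical A).HasBLP) ∧
    (∀ (L : Type*) [DistribLattice L] [BoundedOrder L], IsConormal L →
      (LatFilter.radical L).HasBLP) :=
  ⟨fun _ _ h => h.radical_hasBLP,
    fun _ _ => (ResiduatedLattice.isGelfand_of_prelinear MVAlgebra.prelinear).radical_hasBLP,
    fun _ _ => (ResiduatedLattice.isGelfand_of_prelinear BLAlgebra.prelinear).radical_hasBLP,
    fun _ _ _ h => LatFilter.radical_hasBLP h⟩
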